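/- For distinct $x,y\in 2^\omega$ let $h(x,y)=\min\{n\in\omega : x(n)\neq y(n)\}$, and for $X\subseteq 2^\omega$ let $H(X)=\{h(x,y) : x,y\in X,\ x\neq y\}$. The Raisonnier filter $\mathcal F_X$ of $X$ is the (possibly trivial) filter of all $a\subseteq\omega$ for which there are sets $Y_n\subseteq 2^\omega$ ($n<\omega$) with $X\subseteq\bigcup_{n} Y_n$ and $\bigcup_{n} H(Y_n)\subseteq a$. A (possibly trivial) filter $\mathcal F$ on $\omega$ is rapid if for every increasing $f:\omega\to\omega$ there is $a\in\mathcal F$ with $|\{k\in a : k<f(n)\}|\leq n$ for all $n\in\omega$. Let $\mathcal R=\{X\subseteq 2^\omega : \mathcal F_X\text{ is rapid}\}$, and let $\mathrm{cov}(\mathcal R)$ be the least cardinality of a family $\mathcal C\subseteq\mathcal R$ with $\bigcup\mathcal C=2^\omega$. Let $\mathfrak d$ be the least cardinality of a family $D\subseteq\omega^\omega$ such that for every $f\in\omega^\omega$ there is $g\in D$ with $f(n)\leq g(n)$ for all but finitely many $n$. Let $\mathcal N$ be the ideal of subsets of $2^\omega$ that are null for the fair coin-tossing (Lebesgue) measure,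 and let $\mathrm{cof}(\mathcal N)$ be the least cardinality of a family $\mathcal B\subseteq\mathcal N$ such that every $A\in\mathcal N$ is contained in some $B\in\mathcal B$. **Theorem.** $\mathrm{cof}(\mathcal N)\leq\max\{\mathrm{cov}(\mathcal R),\mathfrak d\}$. -/

import Mathlib

namespace RaisonnierIdeal

open MeasureTheory Filter

/-- The Cantor space of infinite binary sequences. -/
abbrev Cantor : Type := ℕ → Bool

/-- The set of splitting points of `X`: all `min {n | x n ≠ y n}` for distinct `x, y ∈ X`. -/
def splittingPoints (X : Set Cantor) : Set ℕ :=
  {k | ∃ x ∈ X, ∃ y ∈ X, x ≠ y ∧ PiNat.firstDiff x y = k}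

theorem splittingPoints_mono {X Y : Set Cantor} (h : X ⊆ Y) :
    splittingPoints X ⊆ splittingPoints Y := by
  rintro k ⟨x, hx, y, hy, hne, hk⟩
  exact ⟨x, h hx, y, h hy, hne, hk⟩

/-- The Raisonnier filter of `X` (possibly the trivial filter `⊥`): the sets `a` of naturals that
contain all splitting points of all members of some countable cover of `X`. -/
def raisonnierFilter (X : Set Cantor) : Filter ℕ where
  sets := {a | ∃ Y : ℕ → Set Cantor, X ⊆ (⋃ n, Y n) ∧ (⋃ n, splittingPoints (Y n)) ⊆ a}
  univ_sets := ⟨fun _ => X, Set.subset_iUnion (fun _ : ℕ => X) 0, Set.subset_univ _⟩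
  sets_of_superset := by
    rintro a b ⟨Y, hX, hY⟩ hab
    exact ⟨Y, hX, hY.trans hab⟩
  inter_sets := by
    rintro a b ⟨Y, hX, hY⟩ ⟨Z, hX', hZ⟩
    refine ⟨fun n => Y n.unpair.1 ∩ Z n.unpair.2, ?_, ?_⟩
    · intro x hx
      obtain ⟨i, hi⟩ := Set.mem_iUnion.1 (hX hx)
      obtain ⟨j, hj⟩ := Set.mem_iUnion.1 (hX' hx)
      refine Set.mem_iUnion.2 ⟨Nat.pair i j, ?_⟩
      simpa using ⟨hi, hj⟩
    · refine Set.iUnion_subset fun n => Set.subset_inter ?_ ?_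
      · exact ((splittingPoints_mono Set.inter_subset_left).trans
          (Set.subset_iUnion (fun m => splittingPoints (Y m)) n.unpair.1)).trans hY
      · exact ((splittingPoints_mono Set.inter_subset_right).trans
          (Set.subset_iUnion (fun m => splittingPoints (Z m)) n.unpair.2)).trans hZ

/-- A filter on `ℕ` (the trivial filter included) is rapid if for every increasing `f` it has a
member with at most `n` elements below `f n`, for every `n`. -/
def IsRapid (F : Filter ℕ) : Prop :=
  ∀ f : ℕ → ℕ, Monotone f → ∃ a ∈ F, ∀ n, (a ∩ Set.Iio (f n)).ncard ≤ n

/-- The Raisonnier ideal: all sets of binary sequences whose Raisonnier filter is rapid. -/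
def raisonnierIdeal : Set (Set Cantor) :=
  {X | IsRapid (raisonnierFilter X)}

/-- The covering number of a family `I` of subsets of the Cantor space: the least cardinality of
a subfamily of `I` whose union is the whole space. -/
noncomputable def cov (I : Set (Set Cantor)) : Cardinal.{0} :=
  sInf {κ | ∃ C : Set (Set Cantor), C ⊆ I ∧ ⋃₀ C = Set.univ ∧ Cardinal.mk C = κ}

/-- The dominating number: the least cardinality of a family of functions `ℕ → ℕ` such that every
function `ℕ → ℕ` is eventually bounded by a member of the family. -/
noncomputable def dominatingNumber : Cardinal.{0} :=
  sInf {κ | ∃ D : Set (ℕ → ℕ), (∀ f : ℕ → ℕ, ∃ g ∈ D, ∀ᶠ n in atTop, f n ≤ g n) ∧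
    Cardinal.mk D = κ}

/-- The fair coin-tossing (Lebesgue) measure on the Cantor space. -/
noncomputable def coinMeasure : Measure Cantor :=
  Measure.infinitePi fun _ : ℕ => (PMF.uniformOfFintype Bool).toMeasure

/-- The null ideal, ordered by inclusion. As `coinMeasure` is an outer measure on all sets,
arbitrary (not only measurable) null sets are included. -/
abbrev NullIdeal : Type := {A : Set Cantor // coinMeasure A = 0}

end RaisonnierIdeal

namespace RaisonnierIdeal

open MeasureTheory Filter Cardinal TopologicalSpace
open scoped ENNReal

/-! ### Localization by slaloms -/

/-! The link is Bartoszyński's description of cof(N) by slaloms, of which only the upper bound is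
needed. Rapidity supplies the slaloms: if the splitting points of `Y` lie in a set with at most `n`
elements below `F n`, then members of `Y` have at most `2 ^ n` restrictions to `F n`. Coding `f ≤ g`
by its graph, with `F n` large enough for `f n` to be read off below it, turns each piece of a
countable cover of `X` into one slalom (`exists_slaloms_of_mem_raisonnierIdeal`). Running over a
cover by members of the ideal and a dominating family localizes every function
(`exists_localizing_family`). A null set lies in the limsup of clopen sets of measure at most `4⁻¹ ^
k`; a slalom catching their codes keeps `2 ^ k` candidates at stage `k`, so Borel–Cantelli gives a
null superset depending only on the slalom (`cof_nullIdeal_le_of_localizing`). -/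

/-- If all splitting points of `Y` lie in `a`, then a function on `Y` that depends only on the first
`m` coordinates takes at most `2 ^ |a ∩ m|` values. -/
theorem finite_image_and_ncard_le {α : Type*} {Y : Set Cantor} {a : Set ℕ} {m : ℕ}
    (hY : splittingPoints Y ⊆ a) {φ : Cantor → α}
    (hφ : ∀ x y : Cantor, (∀ i < m, x i = y i) → φ x = φ y) :
    (φ '' Y).Finite ∧ (φ '' Y).ncard ≤ 2 ^ (a ∩ Set.Iio m).ncard := by
  have hfin : (a ∩ Set.Iio m).Finite := (Set.finite_Iio m).inter_of_right a
  have : Fintype ↥(a ∩ Set.Iio m) := hfin.fintype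
  choose r hrY hr using fun v : φ '' Y => v.2
  -- Representatives of distinct values differ below `m`, and their first difference is a splitting
  -- point, hence in `a`.
  let ρ : φ '' Y → (↥(a ∩ Set.Iio m) → Bool) := fun v i => r v i
  have hρ : Function.Injective ρ := by
    intro v w h
    apply Subtype.ext
    rw [← hr v, ← hr w]
    refine hφ _ _ fun i hi => ?_
    by_cases hvw : r v = r w
    · rw [hvw]
    refine PiNat.apply_eq_of_lt_firstDiff (hi.trans_le (not_lt.1 fun hlt => ?_))
    exact PiNat.apply_firstDiff_ne hvw
      (congrFun h ⟨_, hY ⟨_, hrY v, _, hrY w, hvw, rfl⟩, hlt⟩)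
  have : Finite (φ '' Y) := Finite.of_injective ρ hρ
  refine ⟨Set.toFinite _, ?_⟩
  have := Nat.card_le_card_of_injective ρ hρ
  rwa [Nat.card_fun, Nat.card_eq_fintype_card (α := Bool), Fintype.card_bool] at this

/-- The characteristic sequence of the graph of `f`. -/
def graphCode (f : ℕ → ℕ) : Cantor := fun k => decide (f k.unpair.1 = k.unpair.2)

/-- The least `j ≤ b` such that `x` takes the value `true` at the pair `(n, j)`. -/
noncomputable def decodeBelow (b n : ℕ) (x : Cantor) : ℕ :=
  sInf {j | j ≤ b ∧ x (Nat.pair n j) = true}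

theorem decodeBelow_graphCode {f : ℕ → ℕ} {b n : ℕ} (h : f n ≤ b) :
    decodeBelow b n (graphCode f) = f n := by
  have : {j | j ≤ b ∧ graphCode f (Nat.pair n j) = true} = {f n} := by
    ext j
    simp only [graphCode, Nat.unpair_pair, decide_eq_true_eq, Set.mem_ofPred_eq,
      Set.mem_singleton_iff]
    exact ⟨fun hj => hj.2.symm, by rintro rfl; exact ⟨h, rfl⟩⟩
  rw [decodeBelow, this, csInf_singleton]

/-- The bound on the search makes decoding depend on finitely many coordinates, as the counting
lemma requires. -/
theorem decodeBelow_congr {b n m : ℕ} (hm : ∀ j ≤ b, Nat.pair n j < m) (x y : Cantor)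
    (h : ∀ i < m, x i = y i) : decodeBelow b n x = decodeBelow b n y := by
  have : {j | j ≤ b ∧ x (Nat.pair n j) = true} = {j | j ≤ b ∧ y (Nat.pair n j) = true} := by
    ext j
    exact and_congr_right fun hj => by rw [h _ (hm j hj)]
  rw [decodeBelow, decodeBelow, this]

/-- For `X` in the Raisonnier ideal, countably many slaloms of width `2 ^ n` localize all functions
below `g` whose code lies in `X`. -/
theorem exists_slaloms_of_mem_raisonnierIdeal {X : Set Cantor} (hX : X ∈ raisonnierIdeal)
    (g : ℕ → ℕ) :
    ∃ S : ℕ → ℕ → Finset ℕ, (∀ k n, (S k n).card ≤ 2 ^ n) ∧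
      ∀ f : ℕ → ℕ, f ≤ g → graphCode f ∈ X → ∃ k, ∀ n, f n ∈ S k n := by
  -- Summing over `i ≤ n` makes `F` monotone, as rapidity demands; the `+ 1` makes the bound on the
  -- codes strict.
  let F : ℕ → ℕ := fun n => ∑ i ∈ Finset.range (n + 1), (Nat.pair i (g i) + 1)
  have hFmono : Monotone F := fun m n h =>
    Finset.sum_le_sum_of_subset (Finset.range_mono (Nat.succ_le_succ h))
  have hF : ∀ n, ∀ j ≤ g n, Nat.pair n j < F n := by
    intro n j hj
    have h₁ : Nat.pair n j ≤ Nat.pair n (g n) := hj.eq_or_lt.elim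
      (fun h => h ▸ le_rfl) fun h => (Nat.pair_lt_pair_right n h).le
    have h₂ : Nat.pair n (g n) + 1 ≤ F n :=
      Finset.single_le_sum (f := fun i => Nat.pair i (g i) + 1) (fun _ _ => Nat.zero_le _)
        (Finset.self_mem_range_succ n)
    omega
  obtain ⟨a, ⟨Y, hXY, hYa⟩, ha⟩ := hX F hFmono
  have key := fun k n => finite_image_and_ncard_le ((Set.iUnion_subset_iff.1 hYa) k)
    (decodeBelow_congr (hF n))
  refine ⟨fun k n => (key k n).1.toFinset, fun k n => ?_, fun f hf hfX => ?_⟩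
  · rw [← Set.ncard_eq_toFinset_card _ (key k n).1]
    exact (key k n).2.trans (Nat.pow_le_pow_right two_pos (ha n))
  · obtain ⟨k, hk⟩ := Set.mem_iUnion.1 (hXY hfX)
    refine ⟨k, fun n => ?_⟩
    rw [Set.Finite.mem_toFinset]
    exact ⟨_, hk, decodeBelow_graphCode (hf n)⟩

theorem exists_cover_mk_eq_cov :
    ∃ C ⊆ raisonnierIdeal, ⋃₀ C = Set.univ ∧ #C = cov raisonnierIdeal := by
  have hne : {κ | ∃ C : Set (Set Cantor), C ⊆ raisonnierIdeal ∧ ⋃₀ C = Set.univ ∧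
      #C = κ}.Nonempty := by
    -- Singletons have no splitting points, so even `∅` is in their filter. Without some cover,
    -- `sInf` would take the default value 0.
    refine ⟨_, Set.range fun x : Cantor => ({x} : Set Cantor), ?_, ?_, rfl⟩
    · rintro _ ⟨x, rfl⟩ f -
      refine ⟨∅, ⟨fun _ => {x}, Set.subset_iUnion (fun _ : ℕ => ({x} : Set Cantor)) 0, ?_⟩,
        by simp⟩
      refine Set.iUnion_subset fun _ => ?_
      rintro k ⟨y, rfl, z, rfl, hyz, -⟩
      exact hyz rfl
    · exact Set.eq_univ_of_forall fun x => ⟨{x}, ⟨x, rfl⟩, rfl⟩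
  obtain ⟨C, hC, hU, hκ⟩ := csInf_mem hne
  exact ⟨C, hC, hU, hκ⟩

theorem exists_dominating_mk_eq :
    ∃ D : Set (ℕ → ℕ), (∀ f : ℕ → ℕ, ∃ g ∈ D, ∀ᶠ n in atTop, f n ≤ g n) ∧
      #D = dominatingNumber := by
  have hne : {κ | ∃ D : Set (ℕ → ℕ), (∀ f : ℕ → ℕ, ∃ g ∈ D, ∀ᶠ n in atTop, f n ≤ g n) ∧
      #D = κ}.Nonempty :=
    ⟨_, Set.univ, fun f => ⟨f, trivial, Eventually.of_forall fun _ => le_rfl⟩, rfl⟩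
  exact csInf_mem hne

theorem infinite_of_dominating {D : Set (ℕ → ℕ)}
    (hD : ∀ f : ℕ → ℕ, ∃ g ∈ D, ∀ᶠ n in atTop, f n ≤ g n) : D.Infinite := by
  intro hfin
  -- One more than the sum of a finite family exceeds each member everywhere.
  obtain ⟨g, hg, h⟩ := hD fun n => ∑ g ∈ hfin.toFinset, g n + 1
  obtain ⟨n, hn⟩ := h.exists
  have : g n ≤ ∑ g ∈ hfin.toFinset, g n :=
    Finset.single_le_sum (f := fun g : ℕ → ℕ => g n) (fun _ _ => Nat.zero_le _)
      (hfin.mem_toFinset.2 hg)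
  omega

theorem aleph0_le_dominatingNumber : ℵ₀ ≤ dominatingNumber := by
  obtain ⟨D, hD, h⟩ := exists_dominating_mk_eq
  rw [← h]
  exact Cardinal.infinite_iff.1 (infinite_of_dominating hD).to_subtype

/-- A family of `max (cov 𝓡) 𝔡` slaloms of width `2 ^ n` localizes all functions. -/
theorem exists_localizing_family :
    ∃ T : Set (ℕ → Finset ℕ), #T ≤ max (cov raisonnierIdeal) dominatingNumber ∧
      (∀ S ∈ T, ∀ n, (S n).card ≤ 2 ^ n) ∧
      ∀ f : ℕ → ℕ, ∃ S ∈ T, ∀ᶠ n in atTop, f n ∈ S n := by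
  obtain ⟨C, hCR, hC, hCcard⟩ := exists_cover_mk_eq_cov
  obtain ⟨D, hD, hDcard⟩ := exists_dominating_mk_eq
  choose S hS hloc using fun (X : C) (g : D) =>
    exists_slaloms_of_mem_raisonnierIdeal (hCR X.2) g.1
  refine ⟨Set.range fun p : C × D × ℕ => S p.1 p.2.1 p.2.2, ?_, ?_, fun f => ?_⟩
  · refine mk_range_le.trans ?_
    have hω : ℵ₀ ≤ max (cov raisonnierIdeal) dominatingNumber :=
      aleph0_le_dominatingNumber.trans (le_max_right _ _)
    rw [← mul_def, ← mul_def, hCcard, hDcard, mk_nat]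
    exact mul_le_of_le hω (le_max_left _ _) (mul_le_of_le hω (le_max_right _ _) hω)
  · rintro _ ⟨p, rfl⟩ n
    exact hS _ _ _ _
  · obtain ⟨g, hg, hfg⟩ := hD f
    -- Truncating at `g` gives a function below `g` everywhere that still agrees with `f`
    -- eventually.
    obtain ⟨X, hX, hfX⟩ : graphCode (f ⊓ g) ∈ ⋃₀ C := hC ▸ Set.mem_univ _
    obtain ⟨k, hk⟩ := hloc ⟨X, hX⟩ ⟨g, hg⟩ (f ⊓ g) inf_le_right hfX
    refine ⟨_, ⟨(⟨X, hX⟩, ⟨g, hg⟩, k), rfl⟩, ?_⟩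
    filter_upwards [hfg] with n hn
    simpa [min_eq_left hn] using hk n

/-! ### Null sets and sequences of clopen sets -/

section Clopen

variable {X : Type*} [TopologicalSpace X] [CompactSpace X] [T2Space X]
  [TotallyDisconnectedSpace X] [SecondCountableTopology X]

/-- Disjointness makes the measures of the pieces add up to that of `U`, so covers of small measure
yield summable sequences. -/
theorem exists_disjoint_clopens_iUnion_eq {U : Set X} (hU : IsOpen U) :
    ∃ E : ℕ → Clopens X, Pairwise (Function.onFun Disjoint fun i => (E i : Set X)) ∧
      ⋃ i, (E i : Set X) = U := by
  have : Countable (Clopens X) := Clopens.countable_iff_secondCountable.2 inferInstance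
  have : Nonempty {V : Clopens X // (V : Set X) ⊆ U} := ⟨⟨⊥, by simp⟩⟩
  obtain ⟨V, hV⟩ := exists_surjective_nat {V : Clopens X // (V : Set X) ⊆ U}
  let W : ℕ → Set X := fun i => (V i).1
  have hW : ∀ i, IsClopen (disjointed W i) := fun i =>
    disjointedRec (p := IsClopen) (fun _ j ht => ht.diff (V j).1.isClopen) (V i).1.isClopen
  refine ⟨fun i => ⟨disjointed W i, hW i⟩, disjoint_disjointed W, ?_⟩
  change ⋃ i, disjointed W i = U
  rw [iUnion_disjointed]
  refine (Set.iUnion_subset fun i => (V i).2).antisymm fun x hx => ?_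
  obtain ⟨Z, hZ, hxZ, hZU⟩ := isTopologicalBasis_isClopen.exists_subset_of_mem_open hx hU
  obtain ⟨i, hi⟩ := hV ⟨⟨Z, hZ⟩, hZU⟩
  refine Set.mem_iUnion.2 ⟨i, ?_⟩
  rw [hi]
  exact hxZ

variable [MeasurableSpace X] [BorelSpace X] {μ : Measure X} [μ.OuterRegular]

/-- A null set is contained in the limit superior of a summable sequence of clopen sets. -/
theorem exists_clopens_tsum_ne_top_of_null {A : Set X} (hA : μ A = 0) :
    ∃ E : ℕ → Clopens X, ∑' i, μ (E i) ≠ ∞ ∧ ∀ x ∈ A, ∃ᶠ i in atTop, x ∈ E i := by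
  obtain ⟨ε, hε, hεsum⟩ := ENNReal.exists_pos_sum_of_countable one_ne_zero ℕ
  have hop : ∀ k, ∃ U, A ⊆ U ∧ IsOpen U ∧ μ U < ε k := fun k => by
    obtain ⟨U, hAU, hU, hμ⟩ := A.exists_isOpen_lt_of_lt (μ := μ) (ε k)
      (by rw [hA]; exact_mod_cast hε k)
    exact ⟨U, hAU, hU, hμ⟩
  choose U hAU hU hμU using hop
  choose E hdisj hEU using fun k => exists_disjoint_clopens_iUnion_eq (hU k)
  refine ⟨fun i => E i.unpair.1 i.unpair.2, ?_, fun x hx => ?_⟩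
  · have h₁ : ∑' i : ℕ, μ (E i.unpair.1 i.unpair.2) = ∑' p : ℕ × ℕ, μ (E p.1 p.2) :=
      Nat.pairEquiv.symm.tsum_eq fun p : ℕ × ℕ => μ (E p.1 p.2)
    have h₂ : ∀ k, ∑' j, μ (E k j) = μ (U k) := fun k => by
      rw [← hEU k, measure_iUnion (hdisj k) fun j => (E k j).isClopen.isOpen.measurableSet]
    rw [h₁, ENNReal.tsum_prod (f := fun k j => μ (E k j))]
    simp_rw [h₂]
    exact ((ENNReal.tsum_le_tsum fun k => (hμU k).le).trans_lt
      (hεsum.trans ENNReal.one_lt_top)).ne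
  · refine Nat.frequently_atTop_iff_infinite.2 ?_
    have hmem : ∀ k, ∃ j, x ∈ E k j := fun k => by
      have := hAU k hx
      rw [← hEU k] at this
      exact Set.mem_iUnion.1 this
    choose j hj using hmem
    refine Set.infinite_of_injective_forall_mem (f := fun k => Nat.pair k (j k))
      (fun k l h => (Nat.pair_eq_pair.1 h).1) fun k => ?_
    simpa using hj k

/-- A null set is contained in the limit superior of a sequence of clopen sets whose measures are
bounded by any prescribed sequence of positive numbers. -/
theorem exists_clopens_measure_le_of_null {A : Set X} (hA : μ A = 0) {ε : ℕ → ℝ≥0∞}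
    (hε : ∀ k, 0 < ε k) :
    ∃ E : ℕ → Clopens X, (∀ k, μ (E k) ≤ ε k) ∧ ∀ x ∈ A, ∃ᶠ k in atTop, x ∈ E k := by
  obtain ⟨E, hsum, hAE⟩ := exists_clopens_tsum_ne_top_of_null hA
  -- Tails of a convergent series tend to 0: cut the sequence into blocks, the tail from `φ k` on
  -- being at most `ε k`, and unite each block.
  obtain ⟨φ, hφ, hφε⟩ := extraction_forall_of_eventually fun k =>
    (ENNReal.tendsto_sum_nat_add _ hsum).eventually_le_const (hε k)
  refine ⟨fun k => (Finset.Ico (φ k) (φ (k + 1))).sup E, fun k => ?_, fun x hx => ?_⟩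
  · calc μ ↑((Finset.Ico (φ k) (φ (k + 1))).sup E)
        = μ (⋃ i ∈ Finset.Ico (φ k) (φ (k + 1)), (E i : Set X)) := by
          rw [Clopens.coe_finset_sup]
      _ ≤ ∑ i ∈ Finset.Ico (φ k) (φ (k + 1)), μ (E i) := measure_biUnion_finset_le _ _
      _ = ∑ i ∈ Finset.range (φ (k + 1) - φ k), μ (E (i + φ k)) := by
          simp_rw [Finset.sum_Ico_eq_sum_range, add_comm]
      _ ≤ ∑' i, μ (E (i + φ k)) := ENNReal.sum_le_tsum _
      _ ≤ ε k := hφε k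
  · refine frequently_atTop.2 fun K => ?_
    obtain ⟨i, hi, hxi⟩ := frequently_atTop.1 (hAE x hx) (φ K)
    -- Indices below `φ 0` lie in no block; `φ K ≤ i` excludes them and forces the block number to
    -- be at least `K`.
    have hex : ∃ m, i < φ m := ⟨i + 1, (hφ.id_le (i + 1))⟩
    obtain ⟨k, hk⟩ : ∃ k, Nat.find hex = k + 1 := by
      refine Nat.exists_eq_succ_of_ne_zero fun h0 => ?_
      have := Nat.find_spec hex
      rw [h0] at this
      exact absurd (hi.trans_lt this) (not_lt.2 (hφ.monotone (Nat.zero_le K)))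
    have h₁ : i < φ (k + 1) := hk ▸ Nat.find_spec hex
    have h₂ : φ k ≤ i := not_lt.1 (Nat.find_min hex (hk ▸ Nat.lt_succ_self k))
    refine ⟨k, Nat.lt_succ_iff.1 (hφ.lt_iff_lt.1 (hi.trans_lt h₁)), ?_⟩
    exact (Finset.le_sup (f := E) (Finset.mem_Ico.2 ⟨h₂, h₁⟩) : E i ≤ _) hxi

end Clopen

/-! ### The cofinality of the null ideal -/

instance isProbabilityMeasure_coinMeasure : IsProbabilityMeasure coinMeasure := by
  unfold coinMeasure
  infer_instance

instance countable_clopens_cantor : Countable (Clopens Cantor) :=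
  Clopens.countable_iff_secondCountable.2 inferInstance

/-- The sequences lying in infinitely many of the sets `⋃ {V | V has code in S n, μ V ≤ 4⁻ⁿ}`. -/
def slalomNullSet (e : Clopens Cantor → ℕ) (S : ℕ → Finset ℕ) : Set Cantor :=
  {x | ∃ᶠ n in atTop, ∃ V : Clopens Cantor, e V ∈ S n ∧ coinMeasure V ≤ 4⁻¹ ^ n ∧ x ∈ V}

/-- Borel–Cantelli: stage `n` has measure at most `2 ^ n * 4⁻¹ ^ n = 2⁻¹ ^ n`. The measure condition
in `slalomNullSet` discards codes of large clopen sets that a slalom may contain. -/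
theorem coinMeasure_slalomNullSet {e : Clopens Cantor → ℕ} (he : Function.Injective e)
    {S : ℕ → Finset ℕ} (hS : ∀ n, (S n).card ≤ 2 ^ n) :
    coinMeasure (slalomNullSet e S) = 0 := by
  let P : ℕ → Set (Clopens Cantor) := fun n => {V | e V ∈ S n ∧ coinMeasure V ≤ 4⁻¹ ^ n}
  have hP : ∀ n, (P n).Finite := fun n =>
    ((S n).finite_toSet.preimage he.injOn).subset fun V hV => hV.1
  have hcard : ∀ n, (hP n).toFinset.card ≤ 2 ^ n := fun n => by
    refine le_trans (Finset.card_le_card_of_injOn e (fun V hV => ?_) he.injOn) (hS n)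
    exact ((hP n).mem_toFinset.1 hV).1
  have hset : slalomNullSet e S =
      {x | ∃ᶠ n in atTop, x ∈ ⋃ V ∈ (hP n).toFinset, (V : Set Cantor)} := by
    ext x
    simp [slalomNullSet, P, and_assoc]
  rw [hset]
  refine measure_setOfPred_frequently_eq_zero (ne_top_of_le_ne_top ?_ (ENNReal.tsum_le_tsum
    (g := fun n => 2⁻¹ ^ n) fun n => ?_))
  · simp [ENNReal.tsum_geometric]
  · calc coinMeasure {x | x ∈ ⋃ V ∈ (hP n).toFinset, (V : Set Cantor)}
        ≤ ∑ V ∈ (hP n).toFinset, coinMeasure V := measure_biUnion_finset_le _ _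
      _ ≤ (hP n).toFinset.card • (4⁻¹ : ℝ≥0∞) ^ n :=
          Finset.sum_le_card_nsmul _ _ _ fun V hV => ((hP n).mem_toFinset.1 hV).2
      _ ≤ 2 ^ n * 4⁻¹ ^ n := by
          rw [nsmul_eq_mul]
          gcongr
          exact_mod_cast hcard n
      _ = 2⁻¹ ^ n := by
          rw [← mul_pow]
          congr 1
          rw [show (4 : ℝ≥0∞) = 2 * 2 by norm_num,
            ENNReal.mul_inv (Or.inl two_ne_zero) (Or.inl ENNReal.ofNat_ne_top), ← mul_assoc,
            ENNReal.mul_inv_cancel two_ne_zero ENNReal.ofNat_ne_top, one_mul]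

/-- Every family of slaloms of width `2 ^ n` that localizes all functions yields a cofinal family of
null sets. -/
theorem cof_nullIdeal_le_of_localizing {T : Set (ℕ → Finset ℕ)}
    (hT : ∀ S ∈ T, ∀ n, (S n).card ≤ 2 ^ n)
    (hloc : ∀ f : ℕ → ℕ, ∃ S ∈ T, ∀ᶠ n in atTop, f n ∈ S n) :
    Order.cof NullIdeal ≤ #T := by
  obtain ⟨e, he⟩ := exists_injective_nat (Clopens Cantor)
  let B : T → NullIdeal := fun S => ⟨slalomNullSet e S, coinMeasure_slalomNullSet he (hT S S.2)⟩
  have hB : IsCofinal (Set.range B) := by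
    rintro ⟨A, hA⟩
    obtain ⟨E, hE, hAE⟩ := exists_clopens_measure_le_of_null hA (ε := fun k => 4⁻¹ ^ k)
      fun k => ENNReal.pow_pos (ENNReal.inv_pos.2 ENNReal.ofNat_ne_top) k
    obtain ⟨S, hST, hS⟩ := hloc fun k => e (E k)
    refine ⟨_, ⟨⟨S, hST⟩, rfl⟩, fun x hx => ?_⟩
    exact ((hAE x hx).and_eventually hS).mono fun k hk => ⟨E k, hk.2, hE k, hk.1⟩
  exact (Order.cof_le hB).trans mk_range_le

end RaisonnierIdeal

theorem theorem6p6 :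
    Order.cof RaisonnierIdeal.NullIdeal ≤
      max (RaisonnierIdeal.cov RaisonnierIdeal.raisonnierIdeal)
        RaisonnierIdeal.dominatingNumber := by
  obtain ⟨T, hcard, hT, hloc⟩ := RaisonnierIdeal.exists_localizing_family
  exact (RaisonnierIdeal.cof_nullIdeal_le_of_localizing hT hloc).trans hcard
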